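/- Let $X$ be a separable complex Hilbert space and let $A$ be the infinitesimal generator of an exponentially stable strongly continuous semigroup $(T(t))_{t\ge 0}$ on $X$ (that is, $\|T(t)\|\le M e^{-\omega t}$ for all $t \ge 0$, for some $M$ and some $\omega>0$). Let $(-A)^{1/2}$ denote the square root of $-A$, i.e. the inverse of the injective bounded operator $(-A)^{-1/2}x=\frac{1}{\Gamma(1/2)}\int_0^\infty t^{-1/2}\,T(t)x\,dt$, and let $(-A^*)^{1/2}$ be defined in the same way from the adjoint semigroup $(T(t)^*)_{t\ge0}$, whose generator is $A^*$. A linear map $C:D(A)\to Y$ into a Hilbert space $Y$ is called (infinite-time) admissible for $(T(t))_{t\ge0}$ if $CT(\cdot)x_0\in L^2((0,\infty);Y)$ for all $x_0\in D(A)$ and there is a constant $m$ such that $\int_0^\infty\|CT(t)x_0\|^2\,dt\le m\|x_0\|^2$ for all $x_0\in D(A)$; the map $x_0\mapsto CT(\cdot)x_0$ then extends uniquely to a bounded linear map $X\to L^2((0,\infty);Y)$, denoted by the same symbol. Assume that $(-A)^{1/2}$ (restricted to $D(A)$) is admissible for $(T(t))_{t\ge0}$ and that $(-A^*)^{1/2}$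 (restricted to $D(A^*)$) is admissible for $(T(t)^*)_{t\ge0}$. Then the pair $((-A)^{1/2},A)$ is exactly observable: $(-A)^{1/2}$ is admissible and there is a constant $m_1>0$ such that $$\int_0^\infty\|(-A)^{1/2}T(t)x_0\|^2\,dt\ \ge\ m_1\|x_0\|^2\qquad\text{for all }x_0\in X.$$ Consequently $(T(t))_{t\ge0}$ is similar to a contraction semigroup: there is a boundedly invertible operator $S$ on $X$ such that $\|S\,T(t)\,S^{-1}\|\le 1$ for all $t\ge0$. -/

import Mathlib

open MeasureTheory Set Filter Topology
open scoped NNReal InnerProduct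

/-- A strongly continuous semigroup `(T(t))_{t ≥ 0}` of bounded operators on `X`. -/
structure C0Semigroup (X : Type*) [NormedAddCommGroup X] [NormedSpace ℂ X] where
  toFun : ℝ≥0 → X →L[ℂ] X
  map_zero' : toFun 0 = ContinuousLinearMap.id ℂ X
  map_add' : ∀ s t : ℝ≥0, toFun (s + t) = (toFun s).comp (toFun t)
  continuous' : ∀ x : X, Continuous fun t : ℝ≥0 => toFun t x

namespace C0Semigroup

section Basic

variable {X : Type*} [NormedAddCommGroup X] [NormedSpace ℂ X]

instance : CoeFun (C0Semigroup X) (fun _ => ℝ≥0 → X →L[ℂ] X) := ⟨toFun⟩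

theorem zero_apply (T : C0Semigroup X) (x : X) : T 0 x = x := by
  rw [T.map_zero']; rfl

theorem add_apply (T : C0Semigroup X) (s t : ℝ≥0) (x : X) : T (s + t) x = T s (T t x) := by
  rw [T.map_add']; rfl

theorem comm_apply (T : C0Semigroup X) (s t : ℝ≥0) (x : X) : T s (T t x) = T t (T s x) := by
  rw [← T.add_apply, ← T.add_apply, add_comm]

theorem continuous_orbit (T : C0Semigroup X) (x : X) :
    Continuous fun t : ℝ => T t.toNNReal x :=
  (T.continuous' x).comp continuous_real_toNNReal

/-- The graph of the infinitesimal generator: the pairs `(x, y)` such that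
`(T(h) x - x) / h → y` as `h ↓ 0`. -/
def generatorGraph (T : C0Semigroup X) : Submodule ℂ (X × X) where
  carrier := {p | Tendsto (fun h : ℝ => h⁻¹ • (T h.toNNReal p.1 - p.1)) (𝓝[>] 0) (𝓝 p.2)}
  zero_mem' := by simp
  add_mem' := by
    intro p q hp hq
    simp only [Set.mem_ofPred_eq, Prod.fst_add, Prod.snd_add] at *
    refine (hp.add hq).congr fun h => ?_
    rw [map_add, ← smul_add]
    congr 1
    abel
  smul_mem' := by
    intro c p hp
    simp only [Set.mem_ofPred_eq, Prod.smul_fst, Prod.smul_snd] at *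
    refine (hp.const_smul c).congr fun h => ?_
    rw [map_smul, ← smul_sub, smul_comm]

/-- The infinitesimal generator `A` of the semigroup, an unbounded operator. -/
noncomputable def generator (T : C0Semigroup X) : X →ₗ.[ℂ] X :=
  T.generatorGraph.toLinearPMap

theorem generatorGraph_zero (T : C0Semigroup X) (p : X × X) (hp : p ∈ T.generatorGraph)
    (h0 : p.1 = 0) : p.2 = 0 := by
  have h : Tendsto (fun h : ℝ => h⁻¹ • (T h.toNNReal p.1 - p.1)) (𝓝[>] 0) (𝓝 p.2) := hp
  refine tendsto_nhds_unique h ?_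
  simp [h0]

/-- The defining property of the generator. -/
theorem tendsto_generator (T : C0Semigroup X) (x : T.generator.domain) :
    Tendsto (fun h : ℝ => h⁻¹ • (T h.toNNReal (x : X) - x)) (𝓝[>] 0) (𝓝 (T.generator x)) :=
  T.generatorGraph.mem_graph_toLinearPMap (fun p hp h0 => T.generatorGraph_zero p hp h0) x

/-- The domain `D(A)` is invariant under the semigroup. -/
theorem apply_mem_domain (T : C0Semigroup X) (t : ℝ≥0) (x : T.generator.domain) :
    T t (x : X) ∈ T.generator.domain := by
  refine (Submodule.mem_map).2 ⟨(T t (x : X), T t (T.generator x)), ?_, rfl⟩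
  change Tendsto (fun h : ℝ => h⁻¹ • (T h.toNNReal (T t (x : X)) - T t (x : X))) (𝓝[>] 0)
    (𝓝 (T t (T.generator x)))
  refine (((T t).continuous.tendsto _).comp (T.tendsto_generator x)).congr fun h => ?_
  simp only [Function.comp_apply]
  rw [T.comm_apply, ← map_sub]
  exact ((T t).restrictScalars ℝ).map_smul _ _

/-- The orbit `t ↦ T(t) x` of a point `x ∈ D(A)`, as an element of `D(A)`. -/
noncomputable def domainOrbit (T : C0Semigroup X) (x : T.generator.domain) (t : ℝ) :
    T.generator.domain :=
  ⟨T t.toNNReal x, T.apply_mem_domain t.toNNReal x⟩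

/-- Exponential stability: `‖T(t)‖ ≤ M e^{-ω t}` for some `M` and some `ω > 0`. -/
def IsExpStable (T : C0Semigroup X) : Prop :=
  ∃ M ω : ℝ, 0 < ω ∧ ∀ t : ℝ≥0, ‖T t‖ ≤ M * Real.exp (-(ω * t))

/-- `C : D(A) → Y` linear is an infinite-time admissible output operator. -/
def IsAdmissible (T : C0Semigroup X) {Y : Type*} [NormedAddCommGroup Y] [NormedSpace ℂ Y]
    (C : T.generator.domain →ₗ[ℂ] Y) : Prop :=
  (∀ x : T.generator.domain,
    MemLp (fun t : ℝ => C (T.domainOrbit x t)) 2 (volume.restrict (Ioi (0 : ℝ)))) ∧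
  ∃ m : ℝ, ∀ x : T.generator.domain,
    ∫ t in Ioi (0 : ℝ), ‖C (T.domainOrbit x t)‖ ^ 2 ≤ m * ‖(x : X)‖ ^ 2

/-- `O : X → L²((0,∞);Y)` is the output map of `C`: the bounded extension to all of `X` of
`x ↦ C T(·) x`, `x ∈ D(A)`. It is unique since `D(A)` is dense. -/
def IsOutputMap (T : C0Semigroup X) {Y : Type*} [NormedAddCommGroup Y] [NormedSpace ℂ Y]
    (C : T.generator.domain →ₗ[ℂ] Y)
    (O : X →L[ℂ] Lp Y 2 (volume.restrict (Ioi (0 : ℝ)))) : Prop :=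
  ∀ x : T.generator.domain,
    (O (x : X) : ℝ → Y) =ᵐ[volume.restrict (Ioi (0 : ℝ))] fun t => C (T.domainOrbit x t)

/-- `(C, A)` is exactly observable: `C` is admissible and, for its output map
`x ↦ C T(·) x` on `X`, `∫₀^∞ ‖C T(t) x‖² dt ≥ m₁ ‖x‖²` for all `x ∈ X`, with some `m₁ > 0`. -/
def IsExactlyObservable (T : C0Semigroup X) {Y : Type*} [NormedAddCommGroup Y] [NormedSpace ℂ Y]
    (C : T.generator.domain →ₗ[ℂ] Y) : Prop :=
  T.IsAdmissible C ∧
  ∃ O : X →L[ℂ] Lp Y 2 (volume.restrict (Ioi (0 : ℝ))), T.IsOutputMap C O ∧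
    ∃ m₁ : ℝ, 0 < m₁ ∧ ∀ x : X, m₁ * ‖x‖ ^ 2 ≤ ∫ t in Ioi (0 : ℝ), ‖(O x : ℝ → Y) t‖ ^ 2

/-- Similarity to a contraction semigroup: for some boundedly invertible `S` on `X`, all the
operators `S T(t) S⁻¹` are contractions. -/
def IsSimilarToContraction (T : C0Semigroup X) : Prop :=
  ∃ S : X ≃L[ℂ] X, ∀ t : ℝ≥0, ‖(S : X →L[ℂ] X) ∘L T t ∘L (S.symm : X →L[ℂ] X)‖ ≤ 1

theorem integrableOn_rpow_orbit (T : C0Semigroup X) (hT : T.IsExpStable) {r : ℝ} (hr : -1 < r)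
    (x : X) : IntegrableOn (fun t : ℝ => t ^ r • T t.toNNReal x) (Ioi 0) := by
  obtain ⟨M, ω, hω, hM⟩ := hT
  have h1 := (integrableOn_rpow_mul_exp_neg_mul_rpow hr one_pos hω).const_mul (M * ‖x‖)
  refine h1.mono' ?_ ?_
  · exact ((measurable_id.pow_const r).aestronglyMeasurable).smul
      (T.continuous_orbit x).aestronglyMeasurable
  · refine (ae_restrict_iff' measurableSet_Ioi).2 (Eventually.of_forall fun t ht => ?_)
    have ht : 0 < t := ht
    have h2 := (T t.toNNReal).le_of_opNorm_le (hM t.toNNReal) x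
    rw [Real.coe_toNNReal t ht.le] at h2
    rw [norm_smul, Real.norm_of_nonneg (Real.rpow_nonneg ht.le r), Real.rpow_one, neg_mul]
    calc t ^ r * ‖T t.toNNReal x‖ ≤ t ^ r * (M * Real.exp (-(ω * t)) * ‖x‖) := by gcongr
      _ = _ := by ring

theorem integrableOn_orbit (T : C0Semigroup X) (hT : T.IsExpStable) (x : X) :
    IntegrableOn (fun t : ℝ => T t.toNNReal x) (Ioi 0) := by
  simpa using T.integrableOn_rpow_orbit hT (r := 0) (by norm_num) x

/-- The operator `(-A)^{-1/2} x = Γ(1/2)⁻¹ ∫₀^∞ t^{-1/2} T(t) x dt`. -/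
noncomputable def invSqrtNeg (T : C0Semigroup X) (hT : T.IsExpStable) : X →ₗ[ℂ] X where
  toFun x := (Real.Gamma (1 / 2))⁻¹ • ∫ t in Ioi (0 : ℝ), t ^ (-(1 / 2) : ℝ) • T t.toNNReal x
  map_add' x y := by
    rw [← smul_add, ← integral_add (T.integrableOn_rpow_orbit hT (by norm_num) x)
      (T.integrableOn_rpow_orbit hT (by norm_num) y)]
    simp only [map_add, smul_add]
  map_smul' c x := by
    simp only [map_smul, RingHom.id_apply]
    rw [smul_comm c, ← integral_smul c]
    congr 2
    funext t
    rw [smul_comm]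

/-- The square root `(-A)^{1/2}`: the inverse of the injective operator `(-A)^{-1/2}`, whose
domain is the range of `(-A)^{-1/2}`. -/
noncomputable def sqrtNeg (T : C0Semigroup X) (hT : T.IsExpStable) : X →ₗ.[ℂ] X :=
  ((T.invSqrtNeg hT).toPMap ⊤).inverse

end Basic

section Complete

variable {X : Type*} [NormedAddCommGroup X] [NormedSpace ℂ X] [CompleteSpace X]

/-- The bounded operator `x ↦ ∫₀^∞ T(t) x dt`. -/
theorem exists_potential (T : C0Semigroup X) (hT : T.IsExpStable) :
    ∃ B : X →L[ℂ] X, ∀ x, B x = ∫ t in Ioi (0 : ℝ), T t.toNNReal x := by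
  have hT' := hT
  obtain ⟨M, ω, hω, hM⟩ := hT
  refine ⟨LinearMap.mkContinuous
    { toFun := fun x => ∫ t in Ioi (0 : ℝ), T t.toNNReal x
      map_add' := fun x y => by
        rw [← integral_add (T.integrableOn_orbit hT' x) (T.integrableOn_orbit hT' y)]
        simp only [map_add]
      map_smul' := fun c x => by
        rw [← integral_smul]
        simp only [map_smul, RingHom.id_apply] }
    (∫ t in Ioi (0 : ℝ), M * Real.exp (-ω * t)) ?_, fun x => rfl⟩
  intro x
  change ‖∫ t in Ioi (0 : ℝ), T t.toNNReal x‖ ≤ _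
  rw [← integral_mul_const]
  refine norm_integral_le_of_norm_le
    (((integrableOn_exp_mul_Ioi (neg_lt_zero.2 hω) 0).const_mul M).mul_const ‖x‖) ?_
  refine (ae_restrict_iff' measurableSet_Ioi).2 (Eventually.of_forall fun t ht => ?_)
  have ht : 0 < t := ht
  have h2 := (T t.toNNReal).le_of_opNorm_le (hM t.toNNReal) x
  rwa [Real.coe_toNNReal t ht.le, ← neg_mul] at h2

theorem potential_comm (T : C0Semigroup X) (hT : T.IsExpStable) (B : X →L[ℂ] X)
    (hB : ∀ x, B x = ∫ t in Ioi (0 : ℝ), T t.toNNReal x) (s : ℝ≥0) (x : X) :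
    B (T s x) = T s (B x) := by
  rw [hB, hB, ← (T s).integral_comp_comm (T.integrableOn_orbit hT x)]
  simp only [T.comm_apply s]

theorem potential_shift (T : C0Semigroup X) (hT : T.IsExpStable) (B : X →L[ℂ] X)
    (hB : ∀ x, B x = ∫ t in Ioi (0 : ℝ), T t.toNNReal x) {a : ℝ} (ha : 0 ≤ a) (x : X) :
    B x = (∫ t in (0 : ℝ)..a, T t.toNNReal x) + B (T a.toNNReal x) := by
  have hi := T.integrableOn_orbit hT x
  have h1 : B (T a.toNNReal x) = ∫ t in Ioi a, T t.toNNReal x := by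
    rw [hB, ← integral_indicator measurableSet_Ioi, ← integral_indicator measurableSet_Ioi,
      ← integral_add_right_eq_self ((Ioi a).indicator fun t : ℝ => T t.toNNReal x) a]
    congr 1
    funext t
    by_cases ht : 0 < t
    · rw [indicator_of_mem (mem_Ioi.2 ht),
        indicator_of_mem (show t + a ∈ Ioi a from mem_Ioi.2 (by linarith)),
        Real.toNNReal_add ht.le ha, T.add_apply]
    · rw [indicator_of_notMem (show t ∉ Ioi (0 : ℝ) from ht),
        indicator_of_notMem (fun h => ht (by have := mem_Ioi.1 h; linarith))]
  rw [h1, hB, intervalIntegral.integral_interval_add_Ioi' ?_ ?_]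
  · exact (T.continuous_orbit x).intervalIntegrable _ _
  · exact hi.mono_set (Ioi_subset_Ioi ha)

theorem tendsto_average (T : C0Semigroup X) (x : X) :
    Tendsto (fun h : ℝ => h⁻¹ • ∫ t in (0 : ℝ)..h, T t.toNNReal x) (𝓝[>] 0) (𝓝 x) := by
  have h := (intervalIntegral.integral_hasDerivAt_right
    ((T.continuous_orbit x).intervalIntegrable 0 0)
    ((T.continuous_orbit x).stronglyMeasurableAtFilter _ _)
    (T.continuous_orbit x).continuousAt).hasDerivWithinAt (s := Ioi 0)
  rw [hasDerivWithinAt_iff_tendsto_slope' (by simp)] at h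
  simpa [slope_fun_def, T.zero_apply] using h

theorem potential_injective (T : C0Semigroup X) (hT : T.IsExpStable) (B : X →L[ℂ] X)
    (hB : ∀ x, B x = ∫ t in Ioi (0 : ℝ), T t.toNNReal x) (x : X) (hx : B x = 0) : x = 0 := by
  refine tendsto_nhds_unique ((T.tendsto_average x).congr' ?_) tendsto_const_nhds
  filter_upwards [self_mem_nhdsWithin] with h hh
  have h1 := T.potential_shift hT B hB (le_of_lt hh) x
  rw [T.potential_comm hT B hB, hx, map_zero, add_zero] at h1
  rw [← h1, smul_zero]

/-- `∫₀^∞ T(t) A x dt = -x` for `x ∈ D(A)`. -/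
theorem potential_generator (T : C0Semigroup X) (hT : T.IsExpStable) (B : X →L[ℂ] X)
    (hB : ∀ x, B x = ∫ t in Ioi (0 : ℝ), T t.toNNReal x) (x : T.generator.domain) :
    B (T.generator x) = -(x : X) := by
  refine tendsto_nhds_unique (((B.continuous.tendsto _).comp (T.tendsto_generator x)).congr' ?_)
    (T.tendsto_average (x : X)).neg
  filter_upwards [self_mem_nhdsWithin] with h hh
  have h1 := T.potential_shift hT B hB (le_of_lt hh) (x : X)
  simp only [Function.comp_apply]
  rw [show B (h⁻¹ • (T h.toNNReal (x : X) - x)) = h⁻¹ • B (T h.toNNReal (x : X) - x) from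
    (B.restrictScalars ℝ).map_smul _ _, map_sub, ← smul_neg]
  congr 1
  rw [h1]
  abel

theorem graph_generator (T : C0Semigroup X) : T.generator.graph = T.generatorGraph :=
  T.generatorGraph.toLinearPMap_graph_eq fun p hp h0 => T.generatorGraph_zero p hp h0

theorem mem_generatorGraph_iff (T : C0Semigroup X) (hT : T.IsExpStable) (B : X →L[ℂ] X)
    (hB : ∀ x, B x = ∫ t in Ioi (0 : ℝ), T t.toNNReal x) (x y : X) :
    (x, y) ∈ T.generatorGraph ↔ x = -(B y) := by
  constructor
  · intro h
    rw [← graph_generator, LinearPMap.mem_graph_iff] at h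
    obtain ⟨x', h1, h2⟩ := h
    simp only at h1 h2
    rw [← h1, ← h2, T.potential_generator hT B hB, neg_neg]
  · rintro rfl
    change Tendsto (fun h : ℝ => h⁻¹ • (T h.toNNReal (-(B y)) - -(B y))) (𝓝[>] 0) (𝓝 y)
    refine (T.tendsto_average y).congr' ?_
    filter_upwards [self_mem_nhdsWithin] with h hh
    have h1 := T.potential_shift hT B hB (le_of_lt hh) y
    rw [map_neg, ← T.potential_comm hT B hB]
    congr 1
    rw [h1]
    abel

/-- The domain `D(A)` is dense. -/
theorem dense_domain (T : C0Semigroup X) (hT : T.IsExpStable) :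
    Dense (T.generator.domain : Set X) := by
  obtain ⟨B, hB⟩ := T.exists_potential hT
  have hmem : ∀ y : X, B y ∈ T.generator.domain := by
    intro y
    have h : (-(B y), y) ∈ T.generatorGraph := (T.mem_generatorGraph_iff hT B hB _ _).2 rfl
    have h2 : -(B y) ∈ T.generator.domain := (Submodule.mem_map).2 ⟨_, h, rfl⟩
    simpa using h2
  intro x
  refine mem_closure_of_tendsto (T.tendsto_average x) ?_
  filter_upwards [self_mem_nhdsWithin] with h hh
  have h1 := T.potential_shift hT B hB (le_of_lt hh) x
  have h2 : (∫ t in (0 : ℝ)..h, T t.toNNReal x) ∈ T.generator.domain := by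
    rw [← sub_eq_iff_eq_add.2 h1]
    exact T.generator.domain.sub_mem (hmem _) (hmem _)
  have := T.generator.domain.smul_mem ((h⁻¹ : ℝ) : ℂ) h2
  rwa [Complex.coe_smul] at this

theorem integral_rpow_mul_rpow {u : ℝ} (hu : 0 < u) :
    ∫ s in (0 : ℝ)..u, s ^ (-(1 / 2) : ℝ) * (u - s) ^ (-(1 / 2) : ℝ) = Real.Gamma (1 / 2) ^ 2 := by
  have h := Complex.betaIntegral_scaled (1 / 2) (1 / 2) hu
  have h2 := Complex.Gamma_mul_Gamma_eq_betaIntegral (s := 1 / 2) (t := 1 / 2)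
    (by norm_num) (by norm_num)
  have e1 : (1 / 2 + 1 / 2 : ℂ) = 1 := by norm_num
  have e2 : (1 / 2 - 1 : ℂ) = ((-(1 / 2) : ℝ) : ℂ) := by push_cast; norm_num
  have e3 : Complex.Gamma (1 / 2) = (Real.Gamma (1 / 2) : ℂ) := by
    rw [← Complex.Gamma_ofReal]; push_cast; rfl
  rw [e1, Complex.Gamma_one, one_mul] at h2
  rw [e1, sub_self, Complex.cpow_zero, one_mul, ← h2, e2, e3] at h
  have h3 : ((∫ s in (0 : ℝ)..u, s ^ (-(1 / 2) : ℝ) * (u - s) ^ (-(1 / 2) : ℝ) : ℝ) : ℂ)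
      = ((Real.Gamma (1 / 2) ^ 2 : ℝ) : ℂ) := by
    rw [← intervalIntegral.integral_ofReal]
    push_cast
    rw [sq, ← h]
    refine intervalIntegral.integral_congr fun s hs => ?_
    rw [uIcc_of_le hu.le] at hs
    rw [Complex.ofReal_cpow hs.1, Complex.ofReal_cpow (sub_nonneg.2 hs.2)]
    push_cast
    rfl
  exact_mod_cast h3

theorem invSqrtNeg_invSqrtNeg (T : C0Semigroup X) (hT : T.IsExpStable) (x : X) :
    T.invSqrtNeg hT (T.invSqrtNeg hT x) = ∫ t in Ioi (0 : ℝ), T t.toNNReal x := by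
  have hT' := hT
  obtain ⟨M, ω, hω, hM⟩ := hT'
  set φ : ℝ → ℝ := (Ioi (0 : ℝ)).indicator fun t => t ^ (-(1 / 2) : ℝ) with hφ
  set ψ : ℝ → ℝ := (Ioi (0 : ℝ)).indicator fun t => t ^ (-(1 / 2) : ℝ) * Real.exp (-ω * t) with hψ
  set G : ℝ → X := fun t => T t.toNNReal x with hG
  have hφm : Measurable φ := (measurable_id.pow_const _).indicator measurableSet_Ioi
  have hψi : Integrable ψ := by
    rw [hψ, integrable_indicator_iff measurableSet_Ioi]
    simpa using integrableOn_rpow_mul_exp_neg_mul_rpow (s := -(1 / 2)) (by norm_num) one_pos hω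
  -- the two-variable integrand, with `u = s + t`
  have hint : Integrable (Function.uncurry fun u s : ℝ => (φ s * φ (u - s)) • G u)
      (volume.prod volume) := by
    have h1 := (Integrable.convolution_integrand (ContinuousLinearMap.mul ℝ ℝ) hψi hψi).const_mul
      (M * ‖x‖)
    refine h1.mono' ?_ (Eventually.of_forall fun p => ?_)
    · have m1 : AEStronglyMeasurable (fun p : ℝ × ℝ => φ p.2 * φ (p.1 - p.2))
          ((volume : Measure ℝ).prod (volume : Measure ℝ)) :=
        ((hφm.comp measurable_snd).mul
          (hφm.comp (measurable_fst.sub measurable_snd))).aestronglyMeasurable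
      have m2 : AEStronglyMeasurable (fun p : ℝ × ℝ => G p.1)
          ((volume : Measure ℝ).prod (volume : Measure ℝ)) :=
        ((T.continuous_orbit x).comp continuous_fst).aestronglyMeasurable
      exact m1.smul m2
    · obtain ⟨u, s⟩ := p
      simp only [Function.uncurry_apply_pair, ContinuousLinearMap.mul_apply']
      by_cases hs : 0 < s
      · by_cases hus : 0 < u - s
        · have hu : 0 ≤ u := by linarith
          have h2 := (T u.toNNReal).le_of_opNorm_le (hM u.toNNReal) x
          rw [Real.coe_toNNReal u hu] at h2
          simp only [hφ, hψ, indicator_of_mem (mem_Ioi.2 hs), indicator_of_mem (mem_Ioi.2 hus)]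
          rw [norm_smul, Real.norm_of_nonneg (by positivity)]
          have h3 : Real.exp (-(ω * u)) = Real.exp (-ω * s) * Real.exp (-ω * (u - s)) := by
            rw [← Real.exp_add]; congr 1; ring
          calc _ ≤ s ^ (-(1 / 2) : ℝ) * (u - s) ^ (-(1 / 2) : ℝ) *
                (M * Real.exp (-(ω * u)) * ‖x‖) := by gcongr
            _ = _ := by rw [h3]; ring
        · simp [hφ, hψ, indicator_of_notMem (show u - s ∉ Ioi (0 : ℝ) from hus)]
      · simp [hφ, hψ, indicator_of_notMem (show s ∉ Ioi (0 : ℝ) from hs)]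
  have hswap := integral_integral_swap hint
  -- inner integral over `s`
  have hin1 : ∀ u : ℝ, ∫ s, (φ s * φ (u - s)) • G u
      = (Ioi (0 : ℝ)).indicator (fun u => Real.Gamma (1 / 2) ^ 2 • G u) u := by
    intro u
    rw [integral_smul_const]
    by_cases hu : 0 < u
    · rw [indicator_of_mem (mem_Ioi.2 hu), ← integral_rpow_mul_rpow hu,
        intervalIntegral.integral_of_le hu.le, integral_Ioc_eq_integral_Ioo,
        ← integral_indicator measurableSet_Ioo]
      congr 2
      funext s
      by_cases hs : 0 < s
      · by_cases hus : s < u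
        · simp [hφ, indicator, hs, hus]
        · simp [hφ, indicator, hs, hus]
      · simp [hφ, indicator, hs]
    · rw [indicator_of_notMem (show u ∉ Ioi (0 : ℝ) from hu)]
      have : (fun s => φ s * φ (u - s)) = fun _ => 0 := by
        funext s
        by_cases hs : 0 < s
        · simp [hφ, indicator, show ¬ s < u by linarith]
        · simp [hφ, indicator, hs]
      rw [this]
      simp
  -- inner integral over `u`
  have hin2 : ∀ s : ℝ, ∫ u, (φ s * φ (u - s)) • G u
      = (Ioi (0 : ℝ)).indicator (fun s => s ^ (-(1 / 2) : ℝ) • T s.toNNReal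
          (∫ t in Ioi (0 : ℝ), t ^ (-(1 / 2) : ℝ) • T t.toNNReal x)) s := by
    intro s
    by_cases hs : 0 < s
    · rw [indicator_of_mem (mem_Ioi.2 hs),
        ← (T s.toNNReal).integral_comp_comm (T.integrableOn_rpow_orbit hT (by norm_num) x),
        ← integral_indicator measurableSet_Ioi, ← integral_smul,
        ← integral_add_right_eq_self _ s]
      congr 1
      funext t
      by_cases ht : 0 < t
      · have e : T s.toNNReal (t ^ (-(1 / 2) : ℝ) • T t.toNNReal x)
            = t ^ (-(1 / 2) : ℝ) • T s.toNNReal (T t.toNNReal x) :=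
          ((T s.toNNReal).restrictScalars ℝ).map_smul _ _
        simp only [indicator_of_mem (mem_Ioi.2 ht), e, hG, hφ, indicator_of_mem (mem_Ioi.2 hs),
          add_sub_cancel_right]
        rw [mul_smul, add_comm t s, Real.toNNReal_add hs.le ht.le, T.add_apply]
      · simp [hφ, indicator, ht]
    · rw [indicator_of_notMem (show s ∉ Ioi (0 : ℝ) from hs)]
      simp [hφ, indicator, hs]
  simp only [hin1, hin2] at hswap
  rw [integral_indicator measurableSet_Ioi, integral_indicator measurableSet_Ioi,
    integral_smul] at hswap
  have hΓ : Real.Gamma (1 / 2) ≠ 0 := (Real.Gamma_pos_of_pos (by norm_num)).ne'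
  have hR : ∀ y, T.invSqrtNeg hT y = (Real.Gamma (1 / 2))⁻¹ •
      ∫ t in Ioi (0 : ℝ), t ^ (-(1 / 2) : ℝ) • T t.toNNReal y := fun y => rfl
  rw [hR (T.invSqrtNeg hT x), hR x]
  have e : ∀ (t : ℝ) (y : X), t ^ (-(1 / 2) : ℝ) • T t.toNNReal ((Real.Gamma (1 / 2))⁻¹ • y)
      = (Real.Gamma (1 / 2))⁻¹ • t ^ (-(1 / 2) : ℝ) • T t.toNNReal y := by
    intro t y
    rw [smul_comm]
    congr 1
    exact ((T t.toNNReal).restrictScalars ℝ).map_smul _ _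
  simp only [e]
  rw [integral_smul, ← hswap, smul_smul, smul_smul]
  rw [show (Real.Gamma (1 / 2))⁻¹ * (Real.Gamma (1 / 2))⁻¹ * Real.Gamma (1 / 2) ^ 2 = 1 by
    field_simp, one_smul]

/-- `(-A)^{-1/2}` is injective, so that its inverse is a genuine operator. -/
theorem ker_invSqrtNeg (T : C0Semigroup X) (hT : T.IsExpStable) :
    LinearMap.ker (T.invSqrtNeg hT) = ⊥ := by
  obtain ⟨B, hB⟩ := T.exists_potential hT
  refine LinearMap.ker_eq_bot'.2 fun x hx => T.potential_injective hT B hB x ?_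
  rw [hB, ← T.invSqrtNeg_invSqrtNeg hT, hx, map_zero]

/-- `D(A) ⊆ D((-A)^{1/2})`. -/
theorem domain_le_sqrtNeg (T : C0Semigroup X) (hT : T.IsExpStable) :
    T.generator.domain ≤ (T.sqrtNeg hT).domain := by
  intro x hx
  obtain ⟨B, hB⟩ := T.exists_potential hT
  have h := T.potential_generator hT B hB ⟨x, hx⟩
  rw [hB, ← T.invSqrtNeg_invSqrtNeg hT] at h
  rw [sqrtNeg, LinearPMap.inverse_domain]
  refine ⟨⟨-T.invSqrtNeg hT (T.generator ⟨x, hx⟩), trivial⟩, ?_⟩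
  change T.invSqrtNeg hT (-T.invSqrtNeg hT (T.generator ⟨x, hx⟩)) = x
  rw [map_neg, h, neg_neg]

/-- The square root `(-A)^{1/2}` as an output operator, i.e. restricted to `D(A)`. -/
noncomputable def sqrtNegOutput (T : C0Semigroup X) (hT : T.IsExpStable) :
    T.generator.domain →ₗ[ℂ] X :=
  (T.sqrtNeg hT).toFun ∘ₗ Submodule.inclusion (T.domain_le_sqrtNeg hT)

end Complete

section Adjoint

variable {X : Type*} [NormedAddCommGroup X] [InnerProductSpace ℂ X] [CompleteSpace X]

theorem adjoint_continuous (T : C0Semigroup X) (hT : T.IsExpStable) (y : X) :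
    Continuous fun t : ℝ≥0 => ContinuousLinearMap.adjoint (T t) y := by
  obtain ⟨B, hB⟩ := T.exists_potential hT
  have hT' := hT
  obtain ⟨M, ω, hω, hM⟩ := hT'
  have hM0 : 0 ≤ M := by
    have := (norm_nonneg _).trans (hM 0)
    simpa using this
  have hM1 : ∀ t : ℝ≥0, ‖T t‖ ≤ M := fun t => (hM t).trans <| by
    refine mul_le_of_le_one_right hM0 (Real.exp_le_one_iff.2 ?_)
    have : 0 ≤ ω * t := by positivity
    linarith
  have hlip : ∀ z x : X, ∀ s t : ℝ, 0 ≤ s → 0 ≤ t →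
      ‖B (T t.toNNReal x) - B (T s.toNNReal x)‖ ≤ M * ‖x‖ * |t - s| := by
    intro z x s t hs ht
    have h1 := T.potential_shift hT B hB hs x
    have h2 := T.potential_shift hT B hB ht x
    have hi : ∀ a b : ℝ, IntervalIntegrable (fun t : ℝ => T t.toNNReal x) volume a b :=
      fun a b => (T.continuous_orbit x).intervalIntegrable _ _
    have h3 : B (T t.toNNReal x) - B (T s.toNNReal x) = ∫ r in t..s, T r.toNNReal x := by
      rw [← intervalIntegral.integral_interval_sub_left (hi 0 s) (hi 0 t)]
      rw [h2] at h1
      rw [sub_eq_sub_iff_add_eq_add, add_comm, h1]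
    rw [h3, abs_sub_comm]
    exact intervalIntegral.norm_integral_le_of_norm_le_const fun r _ =>
      (T r.toNNReal).le_of_opNorm_le (hM1 _) x
  have hdense : Dense (Set.range (ContinuousLinearMap.adjoint B)) := by
    have hk : LinearMap.ker (B : X →ₗ[ℂ] X) = ⊥ :=
      LinearMap.ker_eq_bot'.2 fun x hx => T.potential_injective hT B hB x hx
    have h := B.orthogonal_ker
    rw [hk, Submodule.bot_orthogonal_eq_top] at h
    have h' := (Submodule.dense_iff_topologicalClosure_eq_top
      (s := LinearMap.range (ContinuousLinearMap.adjoint B : X →ₗ[ℂ] X))).2 h.symm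
    exact h'
  have hcont : ∀ z : X, Continuous fun t : ℝ≥0 =>
      ContinuousLinearMap.adjoint (T t) (ContinuousLinearMap.adjoint B z) := by
    intro z
    have e : ∀ t : ℝ≥0, ContinuousLinearMap.adjoint (T t) (ContinuousLinearMap.adjoint B z)
        = ContinuousLinearMap.adjoint (B ∘L T t) z := by
      intro t; rw [ContinuousLinearMap.adjoint_comp]; rfl
    simp only [e]
    have hc : Continuous fun t : ℝ≥0 => B ∘L T t := by
      refine (LipschitzWith.of_dist_le_mul (K := M.toNNReal) fun t s => ?_).continuous
      rw [dist_eq_norm, Real.coe_toNNReal M hM0]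
      refine ContinuousLinearMap.opNorm_le_bound _ (by positivity) fun x => ?_
      have := hlip z x s t s.2 t.2
      simp only [Real.toNNReal_coe] at this
      rw [NNReal.dist_eq]
      calc _ ≤ _ := this
        _ = _ := by ring
    exact (ContinuousLinearMap.adjoint.continuous.comp hc).clm_apply continuous_const
  refine continuous_of_uniform_approx_of_continuous fun u hu => ?_
  obtain ⟨ε, hε, hεu⟩ := Metric.mem_uniformity_dist.1 hu
  obtain ⟨_, ⟨z, rfl⟩, hz⟩ := hdense.exists_dist_lt y (show 0 < ε / (M + 1) by positivity)
  refine ⟨_, hcont z, fun t => hεu ?_⟩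
  rw [dist_eq_norm] at hz
  rw [dist_eq_norm, ← map_sub]
  have hM2 : ‖ContinuousLinearMap.adjoint (T t)‖ ≤ M := by
    rw [LinearIsometryEquiv.norm_map]; exact hM1 t
  calc _ ≤ M * ‖y - ContinuousLinearMap.adjoint B z‖ :=
        ContinuousLinearMap.le_of_opNorm_le _ hM2 _
    _ ≤ (M + 1) * ‖y - ContinuousLinearMap.adjoint B z‖ := by gcongr; linarith
    _ < (M + 1) * (ε / (M + 1)) := by gcongr
    _ = ε := by field_simp

/-- The adjoint semigroup `(T(t)^*)_{t ≥ 0}`; its generator is the adjoint `A^*`. -/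
noncomputable def adjoint (T : C0Semigroup X) (hT : T.IsExpStable) : C0Semigroup X where
  toFun t := ContinuousLinearMap.adjoint (T t)
  map_zero' := by
    rw [T.map_zero']
    exact ContinuousLinearMap.adjoint_id
  map_add' s t := by
    rw [add_comm, T.map_add', ContinuousLinearMap.adjoint_comp]
  continuous' := T.adjoint_continuous hT

/-- The generator of the adjoint semigroup is the Hilbert space adjoint `A^*`. -/
theorem generator_adjoint (T : C0Semigroup X) (hT : T.IsExpStable)
    (hT' : (T.adjoint hT).IsExpStable) : (T.adjoint hT).generator = T.generator.adjoint := by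
  obtain ⟨B, hB⟩ := T.exists_potential hT
  obtain ⟨B', hB'⟩ := (T.adjoint hT).exists_potential hT'
  have hBB : ContinuousLinearMap.adjoint B = B' := by
    symm
    rw [ContinuousLinearMap.eq_adjoint_iff]
    intro x y
    rw [hB', hB, ← inner_conj_symm, ← integral_inner ((T.adjoint hT).integrableOn_orbit hT' x),
      ← integral_inner (T.integrableOn_orbit hT y), ← integral_conj]
    congr 1
    funext t
    rw [inner_conj_symm]
    exact ContinuousLinearMap.adjoint_inner_left _ _ _
  have hd := T.dense_domain hT
  refine LinearPMap.eq_of_eq_graph ?_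
  ext ⟨y, w⟩
  rw [(T.adjoint hT).graph_generator, (T.adjoint hT).mem_generatorGraph_iff hT' B' hB',
    LinearPMap.adjoint_graph_eq_graph_adjoint hd, Submodule.mem_adjoint_iff]
  rw [T.graph_generator]
  constructor
  · intro h a b hab
    have h1 := (T.mem_generatorGraph_iff hT B hB a b).1 hab
    rw [h, h1, inner_neg_left, inner_neg_right, ← hBB, ContinuousLinearMap.adjoint_inner_right,
      sub_self]
  · intro h
    refine ext_inner_left ℂ fun z => ?_
    have h1 := h (-(B z)) z ((T.mem_generatorGraph_iff hT B hB _ _).2 rfl)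
    rw [inner_neg_left, sub_neg_eq_add] at h1
    rw [inner_neg_right, ← hBB, ContinuousLinearMap.adjoint_inner_right]
    exact eq_neg_of_add_eq_zero_left h1

theorem adjoint_isExpStable (T : C0Semigroup X) (hT : T.IsExpStable) :
    (T.adjoint hT).IsExpStable := by
  obtain ⟨M, ω, hω, hM⟩ := id hT
  refine ⟨M, ω, hω, fun t => ?_⟩
  change ‖ContinuousLinearMap.adjoint (T t)‖ ≤ _
  rw [LinearIsometryEquiv.norm_map]
  exact hM t

end Adjoint

end C0Semigroup

/-! Write `O` and `O'` for the output maps of `(-A)^{1/2}` and `(-A^*)^{1/2}`, bounded from `X` into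
`L²((0,∞);X)` by admissibility. The heart of the proof is the duality `⟪O x, O' y⟫ = ½ ⟪x, y⟫`
(`inner_outputMap_sqrtNeg`), that is, `O'^* O = ½ I`. For `x ∈ D(A)` and `y ∈ D(A^*)` put `u =
(-A)^{1/2} x` and `v = (-A^*)^{1/2} y`. The square roots commute with their semigroups, so the left
side is `∫ ⟪T(t) u, T(t)^* v⟫ dt = ∫ ⟪T(2t) u, v⟫ dt = ½ ⟪(-A)^{-1} u, v⟫`. Splitting `(-A)^{-1}`
into two factors `(-A)^{-1/2}` and moving one across the inner product leaves `½ ⟪x, y⟫`; density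
and continuity give all `x, y`.

Taking `y = x`, Cauchy–Schwarz yields `½ ‖x‖² ≤ ‖O x‖ ‖O'‖ ‖x‖`: boundedness of the dual output map
is a lower bound for `O`, which is exact observability.

For similarity, `‖O x‖` is then an equivalent Hilbert norm, equal to `‖S x‖` with `S = (O^*
O)^{1/2}` invertible (`exists_equiv_norm_eq`). The semigroup acts on outputs as the left shift on
`(0,∞)`, hence contracts this norm (`IsOutputMap.norm_apply_le`). -/

open scoped InnerProductSpace

namespace C0Semigroup

section Banach

variable {X : Type*} [NormedAddCommGroup X] [NormedSpace ℂ X] [CompleteSpace X]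

/-! ### The square root and the semigroup -/

/-- `(-A)^{-1/2}` commutes with the semigroup. -/
theorem invSqrtNeg_comm (T : C0Semigroup X) (hT : T.IsExpStable) (s : ℝ≥0) (x : X) :
    T.invSqrtNeg hT (T s x) = T s (T.invSqrtNeg hT x) := by
  have e : ∀ (c : ℝ) (y : X), T s (c • y) = c • T s y := fun c y =>
    ((T s).restrictScalars ℝ).map_smul c y
  change (Real.Gamma (1 / 2))⁻¹ • _ = T s ((Real.Gamma (1 / 2))⁻¹ • _)
  rw [e, ← (T s).integral_comp_comm (T.integrableOn_rpow_orbit hT (by norm_num) x)]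
  simp only [e, T.comm_apply s]

/-- `(-A)^{1/2} (-A)^{-1/2} z = z` whenever `(-A)^{-1/2} z ∈ D(A)`. -/
theorem sqrtNegOutput_eq (T : C0Semigroup X) (hT : T.IsExpStable) (x : T.generator.domain) (z : X)
    (hz : T.invSqrtNeg hT z = x) : T.sqrtNegOutput hT x = z := by
  -- The inverse of a partial map has its intended values only when the kernel is trivial.
  have hker : LinearMap.ker ((T.invSqrtNeg hT).toPMap ⊤).toFun = ⊥ := by
    refine LinearMap.ker_eq_bot'.2 fun y hy => Subtype.ext ?_
    exact LinearMap.ker_eq_bot'.1 (T.ker_invSqrtNeg hT) y hy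
  exact LinearPMap.inverse_apply_eq hker
    (y := Submodule.inclusion (T.domain_le_sqrtNeg hT) x) (x := ⟨z, trivial⟩) hz

/-- `(-A)^{-1/2} (-A)^{1/2} x = x` for `x ∈ D(A)`. -/
theorem invSqrtNeg_sqrtNegOutput (T : C0Semigroup X) (hT : T.IsExpStable)
    (x : T.generator.domain) : T.invSqrtNeg hT (T.sqrtNegOutput hT x) = x := by
  obtain ⟨B, hB⟩ := T.exists_potential hT
  have h := T.potential_generator hT B hB x
  rw [hB, ← T.invSqrtNeg_invSqrtNeg hT] at h
  -- With `R = (-A)^{-1/2}`, the identity `R² A x = -x` exhibits `-R A x` as the preimage of `x`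
  -- under `R`.
  have h' : T.invSqrtNeg hT (-T.invSqrtNeg hT (T.generator x)) = x := by
    rw [map_neg, h, neg_neg]
  rw [T.sqrtNegOutput_eq hT x _ h', h']

/-- `(-A)^{1/2} T(t) x = T(t) (-A)^{1/2} x` for `x ∈ D(A)`. -/
theorem sqrtNegOutput_domainOrbit (T : C0Semigroup X) (hT : T.IsExpStable)
    (x : T.generator.domain) (t : ℝ) :
    T.sqrtNegOutput hT (T.domainOrbit x t) = T t.toNNReal (T.sqrtNegOutput hT x) := by
  refine T.sqrtNegOutput_eq hT _ _ ?_
  rw [T.invSqrtNeg_comm, T.invSqrtNeg_sqrtNegOutput]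
  rfl

/-! ### Output maps and the left shift -/

/-- A function in `L²((0,∞);Y)`, `Y` a Hilbert space, has squared norm `∫₀^∞ ‖f(t)‖² dt`. -/
theorem norm_sq_eq_integral_Ioi {Y : Type*} [NormedAddCommGroup Y] [InnerProductSpace ℂ Y]
    (f : Lp Y 2 (volume.restrict (Ioi (0 : ℝ)))) :
    ‖f‖ ^ 2 = ∫ t in Ioi (0 : ℝ), ‖(f : ℝ → Y) t‖ ^ 2 := by
  have h := L2.inner_def (𝕜 := ℂ) f f
  simp only [inner_self_eq_norm_sq_to_K] at h
  have h2 : ((‖f‖ ^ 2 : ℝ) : ℂ) = ((∫ t in Ioi (0 : ℝ), ‖(f : ℝ → Y) t‖ ^ 2 : ℝ) : ℂ) := by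
    rw [← integral_complex_ofReal]
    push_cast
    exact h
  exact_mod_cast h2

/-- An admissible output operator has an output map. -/
theorem IsAdmissible.exists_isOutputMap {T : C0Semigroup X} (hT : T.IsExpStable) {Y : Type*}
    [NormedAddCommGroup Y] [InnerProductSpace ℂ Y] [CompleteSpace Y]
    {C : T.generator.domain →ₗ[ℂ] Y} (hC : T.IsAdmissible C) :
    ∃ O : X →L[ℂ] Lp Y 2 (volume.restrict (Ioi (0 : ℝ))), T.IsOutputMap C O := by
  obtain ⟨hmem, m, hm⟩ := hC
  let f : T.generator.domain →ₗ[ℂ] Lp Y 2 (volume.restrict (Ioi (0 : ℝ))) :=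
    { toFun := fun x => (hmem x).toLp _
      map_add' := fun x y => by
        rw [← MemLp.toLp_add]
        congr 1
        funext t
        rw [Pi.add_apply, ← map_add]
        exact congrArg C (Subtype.ext (map_add (T t.toNNReal) (x : X) y))
      map_smul' := fun c x => by
        rw [RingHom.id_apply, ← MemLp.toLp_const_smul]
        congr 1
        funext t
        rw [Pi.smul_apply, ← map_smul]
        exact congrArg C (Subtype.ext (map_smul (T t.toNNReal) c (x : X))) }
  have hcoe : ∀ x, (f x : ℝ → Y) =ᵐ[volume.restrict (Ioi (0 : ℝ))]
      fun t => C (T.domainOrbit x t) := fun x => (hmem x).coeFn_toLp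
  have hd : DenseRange T.generator.domain.subtypeL := by
    simpa [DenseRange] using T.dense_domain hT
  -- Admissibility does not require `m ≥ 0`, hence the maximum under the root.
  have hb : ∀ x, ‖f x‖ ≤ √(max m 0) * ‖T.generator.domain.subtypeL x‖ := by
    intro x
    refine le_of_sq_le_sq ?_ (by positivity)
    rw [norm_sq_eq_integral_Ioi, mul_pow, Real.sq_sqrt (le_max_right m 0)]
    calc ∫ t in Ioi (0 : ℝ), ‖(f x : ℝ → Y) t‖ ^ 2
        = ∫ t in Ioi (0 : ℝ), ‖C (T.domainOrbit x t)‖ ^ 2 :=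
          integral_congr_ae ((hcoe x).fun_comp fun y => ‖y‖ ^ 2)
      _ ≤ m * ‖(x : X)‖ ^ 2 := hm x
      _ ≤ _ := by
          change _ ≤ max m 0 * ‖(x : X)‖ ^ 2
          gcongr
          exact le_max_left m 0
  -- The extension is formed unconditionally; density and the bound enter when it is shown to agree
  -- with `f` on `D(A)`.
  refine ⟨f.extendOfNorm T.generator.domain.subtypeL, fun x => ?_⟩
  have h := LinearMap.extendOfNorm_eq hd ⟨_, hb⟩ x
  change f.extendOfNorm T.generator.domain.subtypeL (x : X) = f x at h
  rw [h]
  exact hcoe x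

/-- The output of `T(s) x` is the left shift of the output of `x`, hence has smaller norm. -/
theorem IsOutputMap.norm_apply_le {T : C0Semigroup X} (hT : T.IsExpStable) {Y : Type*}
    [NormedAddCommGroup Y] [InnerProductSpace ℂ Y]
    {C : T.generator.domain →ₗ[ℂ] Y} {O : X →L[ℂ] Lp Y 2 (volume.restrict (Ioi (0 : ℝ)))}
    (hO : T.IsOutputMap C O) (s : ℝ≥0) (x : X) : ‖O (T s x)‖ ≤ ‖O x‖ := by
  refine (T.dense_domain hT).induction (P := fun x => ‖O (T s x)‖ ≤ ‖O x‖) (fun x hx => ?_)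
    (isClosed_le (by fun_prop) (by fun_prop)) x
  have hsq : ∀ y : T.generator.domain, ‖O (y : X)‖ ^ 2
      = ∫ t in Ioi (0 : ℝ), ‖C (T.domainOrbit y t)‖ ^ 2 := fun y => by
    rw [norm_sq_eq_integral_Ioi]
    exact integral_congr_ae ((hO y).fun_comp fun y => ‖y‖ ^ 2)
  refine le_of_sq_le_sq ?_ (norm_nonneg _)
  have hx' := hsq ⟨x, hx⟩
  have hs' := hsq ⟨T s x, T.apply_mem_domain s ⟨x, hx⟩⟩
  simp only at hx' hs'
  -- Integrability on all of `(0,∞)` is what makes the final comparison with the integral over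
  -- `(s,∞)` valid.
  have hint : IntegrableOn (fun t => ‖C (T.domainOrbit ⟨x, hx⟩ t)‖ ^ 2) (Ioi (0 : ℝ)) := by
    refine ((Lp.memLp (O x)).integrable_norm_pow two_ne_zero).congr ?_
    filter_upwards [hO ⟨x, hx⟩] with t ht
    exact congrArg (‖·‖ ^ 2) ht
  have hshift : ∫ t in Ioi (0 : ℝ),
        ‖C (T.domainOrbit ⟨T s x, T.apply_mem_domain s ⟨x, hx⟩⟩ t)‖ ^ 2
      = ∫ t in Ioi (s : ℝ), ‖C (T.domainOrbit ⟨x, hx⟩ t)‖ ^ 2 := by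
    rw [← (measurePreserving_add_right volume (s : ℝ)).setIntegral_preimage_emb
      (measurableEmbedding_addRight (s : ℝ))
      (fun t => ‖C (T.domainOrbit ⟨x, hx⟩ t)‖ ^ 2) (Ioi (s : ℝ)), preimage_add_const_Ioi, sub_self]
    refine setIntegral_congr_fun measurableSet_Ioi fun t ht => ?_
    congr 3
    refine Subtype.ext ?_
    change T t.toNNReal (T s x) = T (t + s).toNNReal x
    rw [Real.toNNReal_add (le_of_lt (mem_Ioi.1 ht)) s.coe_nonneg, T.add_apply, Real.toNNReal_coe]
  rw [hx', hs', hshift]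
  exact setIntegral_mono_set hint (Eventually.of_forall fun t => by positivity)
    (Ioi_subset_Ioi s.2).eventuallyLE

end Banach

section Hilbert

variable {X : Type*} [NormedAddCommGroup X] [InnerProductSpace ℂ X] [CompleteSpace X]

/-! ### Duality of the two output maps -/

/-- `((-A)^{-1/2})^* = (-A^*)^{-1/2}`. -/
theorem inner_invSqrtNeg_left (T : C0Semigroup X) (hT : T.IsExpStable) (x y : X) :
    ⟪T.invSqrtNeg hT x, y⟫_ℂ
      = ⟪x, (T.adjoint hT).invSqrtNeg (T.adjoint_isExpStable hT) y⟫_ℂ := by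
  change ⟪(Real.Gamma (1 / 2))⁻¹ • _, y⟫_ℂ = ⟪x, (Real.Gamma (1 / 2))⁻¹ • _⟫_ℂ
  -- `integral_inner` handles an integral in the second slot only, so the left side is conjugated
  -- first; the real weights pass through either slot.
  rw [inner_smul_left_eq_smul, inner_smul_right_eq_smul, ← inner_conj_symm,
    ← integral_inner (T.integrableOn_rpow_orbit hT (by norm_num) x),
    ← integral_inner ((T.adjoint hT).integrableOn_rpow_orbit (T.adjoint_isExpStable hT)
      (by norm_num) y), ← integral_conj]
  congr 2
  funext t
  rw [inner_conj_symm, inner_smul_left_eq_smul, inner_smul_right_eq_smul]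
  congr 1
  exact (ContinuousLinearMap.adjoint_inner_right _ _ _).symm

/-- `∫₀^∞ ⟨T(t) x, T(t)^* y⟩ dt = ½ ⟨∫₀^∞ T(t) x dt, y⟩`. -/
theorem integral_inner_orbit_adjoint (T : C0Semigroup X) (hT : T.IsExpStable) (x y : X) :
    ∫ t in Ioi (0 : ℝ), ⟪T t.toNNReal x, T.adjoint hT t.toNNReal y⟫_ℂ
      = (1 / 2 : ℝ) • ⟪∫ t in Ioi (0 : ℝ), T t.toNNReal x, y⟫_ℂ := by
  rw [← inner_conj_symm, ← integral_inner (T.integrableOn_orbit hT x), ← integral_conj]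
  simp only [inner_conj_symm]
  -- The integrand is `⟪T(2t) x, y⟫`, and the factor `½` is the Jacobian of `t ↦ 2t`.
  have h := integral_comp_mul_left_Ioi (fun t : ℝ => ⟪T t.toNNReal x, y⟫_ℂ) 0
    (show (0 : ℝ) < 2 by norm_num)
  rw [mul_zero] at h
  rw [one_div, ← h]
  refine setIntegral_congr_fun measurableSet_Ioi fun t ht => ?_
  have ht : 0 ≤ t := le_of_lt ht
  change ⟪T t.toNNReal x, ContinuousLinearMap.adjoint (T t.toNNReal) y⟫_ℂ
    = ⟪T (2 * t).toNNReal x, y⟫_ℂ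
  rw [ContinuousLinearMap.adjoint_inner_right, ← T.add_apply, ← Real.toNNReal_add ht ht, two_mul]

/-- The output maps of `(-A)^{1/2}` and `(-A^*)^{1/2}` are dual to each other up to a factor. -/
theorem inner_outputMap_sqrtNeg (T : C0Semigroup X) (hT : T.IsExpStable)
    {O O' : X →L[ℂ] Lp X 2 (volume.restrict (Ioi (0 : ℝ)))}
    (hO : T.IsOutputMap (T.sqrtNegOutput hT) O)
    (hO' : (T.adjoint hT).IsOutputMap
      ((T.adjoint hT).sqrtNegOutput (T.adjoint_isExpStable hT)) O') (x y : X) :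
    ⟪O x, O' y⟫_ℂ = (1 / 2 : ℝ) • ⟪x, y⟫_ℂ := by
  have hT' := T.adjoint_isExpStable hT
  -- Both sides are continuous in each variable, so `x ∈ D(A)` and `y ∈ D(A^*)` suffice.
  refine (T.dense_domain hT).induction (P := fun x => ⟪O x, O' y⟫_ℂ = (1 / 2 : ℝ) • ⟪x, y⟫_ℂ)
    (fun x hx => ?_) (isClosed_eq (by fun_prop) (by fun_prop)) x
  refine ((T.adjoint hT).dense_domain hT').induction
    (P := fun y => ⟪O x, O' y⟫_ℂ = (1 / 2 : ℝ) • ⟪x, y⟫_ℂ)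
    (fun y hy => ?_) (isClosed_eq (by fun_prop) (by fun_prop)) y
  have h : ⟪O x, O' y⟫_ℂ = ∫ t in Ioi (0 : ℝ), ⟪T t.toNNReal (T.sqrtNegOutput hT ⟨x, hx⟩),
      T.adjoint hT t.toNNReal ((T.adjoint hT).sqrtNegOutput hT' ⟨y, hy⟩)⟫_ℂ := by
    rw [L2.inner_def]
    refine integral_congr_ae ?_
    filter_upwards [hO ⟨x, hx⟩, hO' ⟨y, hy⟩] with t h1 h2
    rw [h1, h2, T.sqrtNegOutput_domainOrbit, (T.adjoint hT).sqrtNegOutput_domainOrbit]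
  -- With `R = (-A)^{-1/2}`: `½ ⟪R² u, v⟫ = ½ ⟪R u, R^* v⟫`, where `R u = x` and `R^* v = y`.
  rw [h, T.integral_inner_orbit_adjoint, ← T.invSqrtNeg_invSqrtNeg hT, T.inner_invSqrtNeg_left,
    (T.adjoint hT).invSqrtNeg_sqrtNegOutput hT', T.invSqrtNeg_sqrtNegOutput hT]

/-! ### An equivalent norm in which the semigroup contracts -/

/-- A bounded operator between Hilbert spaces that is bounded below has an invertible modulus. -/
theorem exists_equiv_norm_eq {H : Type*} [NormedAddCommGroup H] [InnerProductSpace ℂ H]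
    [CompleteSpace H] (O : X →L[ℂ] H) {m : ℝ} (hm : 0 < m)
    (h : ∀ x, m * ‖x‖ ^ 2 ≤ ‖O x‖ ^ 2) : ∃ S : X ≃L[ℂ] X, ∀ x, ‖S x‖ = ‖O x‖ := by
  set G : X →L[ℂ] X := ContinuousLinearMap.adjoint O ∘L O with hG
  have hG0 : 0 ≤ G :=
    (ContinuousLinearMap.nonneg_iff_isPositive G).2
      (ContinuousLinearMap.isPositive_adjoint_comp_self O)
  have hinner : ∀ x, ⟪G x, x⟫_ℂ = ((‖O x‖ ^ 2 : ℝ) : ℂ) := fun x => by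
    rw [hG, ContinuousLinearMap.comp_apply, ContinuousLinearMap.adjoint_inner_left,
      inner_self_eq_norm_sq_to_K]
    push_cast
    rfl
  -- The lower bound on `O` says that `G = O^* O` is coercive, hence invertible.
  have hGu : IsUnit G := by
    refine ContinuousLinearMap.isUnit_of_forall_le_norm_inner_map G (c := ⟨m, hm.le⟩) hm fun x => ?_
    rw [hinner, Complex.norm_real, Real.norm_of_nonneg (by positivity), mul_comm]
    exact h x
  have hSS : CFC.sqrt G * CFC.sqrt G = G := CFC.sqrt_mul_sqrt_self G hG0
  have hSu : IsUnit (CFC.sqrt G) := by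
    rw [← isUnit_pow_iff two_ne_zero, sq, hSS]
    exact hGu
  have hSsa : ContinuousLinearMap.adjoint (CFC.sqrt G) = CFC.sqrt G :=
    (CFC.sqrt_nonneg G).isSelfAdjoint
  obtain ⟨u, hu⟩ := hSu
  refine ⟨ContinuousLinearEquiv.ofUnit u, fun x => ?_⟩
  have e : ContinuousLinearEquiv.ofUnit u x = CFC.sqrt G x := by rw [← hu]; rfl
  rw [e, ← sq_eq_sq₀ (norm_nonneg _) (norm_nonneg _)]
  have h1 := hinner x
  -- For the self-adjoint root `S`, `‖S x‖² = ⟪S² x, x⟫ = ⟪G x, x⟫ = ‖O x‖²`.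
  rw [← hSS, mul_apply_eq_comp, ← ContinuousLinearMap.adjoint_inner_right, hSsa,
    inner_self_eq_norm_sq_to_K] at h1
  refine Complex.ofReal_injective ?_
  push_cast at h1 ⊢
  exact h1

/-- Exact observability yields similarity to a contraction semigroup. -/
theorem IsExactlyObservable.isSimilarToContraction {T : C0Semigroup X} (hT : T.IsExpStable)
    {Y : Type*} [NormedAddCommGroup Y] [InnerProductSpace ℂ Y] [CompleteSpace Y]
    {C : T.generator.domain →ₗ[ℂ] Y} (hC : T.IsExactlyObservable C) :
    T.IsSimilarToContraction := by
  obtain ⟨-, O, hO, m, hm, h⟩ := hC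
  obtain ⟨S, hS⟩ := exists_equiv_norm_eq O hm fun x => by
    rw [norm_sq_eq_integral_Ioi]
    exact h x
  refine ⟨S, fun t => ContinuousLinearMap.opNorm_le_bound _ zero_le_one fun y => ?_⟩
  change ‖S (T t (S.symm y))‖ ≤ 1 * ‖y‖
  calc ‖S (T t (S.symm y))‖ = ‖O (T t (S.symm y))‖ := hS _
    _ ≤ ‖O (S.symm y)‖ := hO.norm_apply_le hT t _
    _ = 1 * ‖y‖ := by rw [← hS, S.apply_symm_apply, one_mul]

end Hilbert

end C0Semigroup

/-! ### The main theorem -/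

/-- If `A` generates an exponentially stable semigroup on a Hilbert space, `(-A)^{1/2}` is
admissible for the semigroup and `(-A^*)^{1/2}` is admissible for the adjoint semigroup, then
`((-A)^{1/2}, A)` is exactly observable, and the semigroup is similar to a contraction
semigroup. -/
theorem mainTheorem9 {X : Type*} [NormedAddCommGroup X] [InnerProductSpace ℂ X] [CompleteSpace X]
    [TopologicalSpace.SeparableSpace X] (T : C0Semigroup X) (hT : T.IsExpStable)
    (h₁ : T.IsAdmissible (T.sqrtNegOutput hT))
    (h₂ : (T.adjoint hT).IsAdmissible
      ((T.adjoint hT).sqrtNegOutput (T.adjoint_isExpStable hT))) :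
    T.IsExactlyObservable (T.sqrtNegOutput hT) ∧ T.IsSimilarToContraction := by
  have hobs : T.IsExactlyObservable (T.sqrtNegOutput hT) := by
    obtain ⟨O, hO⟩ := h₁.exists_isOutputMap hT
    obtain ⟨O', hO'⟩ := h₂.exists_isOutputMap (T.adjoint_isExpStable hT)
    -- The constant comes from `‖x‖ ≤ 2 ‖O'‖ ‖O x‖`; adding `1` keeps it positive when `O' = 0`,
    -- which happens only for trivial `X`.
    refine ⟨h₁, O, hO, ((2 * (‖O'‖ + 1)) ^ 2)⁻¹, by positivity, fun x => ?_⟩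
    rw [← C0Semigroup.norm_sq_eq_integral_Ioi, inv_mul_le_iff₀ (by positivity), ← mul_pow]
    refine pow_le_pow_left₀ (norm_nonneg _) ?_ 2
    -- The case `x = 0` is separated because the Cauchy–Schwarz estimate is divided by `‖x‖`.
    rcases (norm_nonneg x).eq_or_lt with hx | hx
    · rw [← hx]
      positivity
    have h := T.inner_outputMap_sqrtNeg hT hO hO' x x
    have h3 : (1 / 2 : ℝ) * ‖x‖ ^ 2 ≤ ‖O x‖ * ((‖O'‖ + 1) * ‖x‖) := by
      calc (1 / 2 : ℝ) * ‖x‖ ^ 2 = ‖⟪O x, O' x⟫_ℂ‖ := by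
            rw [h, norm_smul, inner_self_eq_norm_sq_to_K]
            norm_num
        _ ≤ ‖O x‖ * ‖O' x‖ := norm_inner_le_norm _ _
        _ ≤ ‖O x‖ * ((‖O'‖ + 1) * ‖x‖) := by
            gcongr
            exact O'.le_of_opNorm_le (by linarith) x
    nlinarith
  exact ⟨hobs, hobs.isSimilarToContraction hT⟩
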